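/- A quantale is a complete lattice $Q$ (greatest element $1$) with an associative multiplication preserving arbitrary joins in each variable. Let $Q$ be a unital involutive quantale: it has a multiplicative unit $e$ and a join-preserving map $a\mapsto a^*$ with $a^{**}=a$ and $(ab)^*=b^*a^*$. Definitions. $Q$ is a *quantal frame* if $a\wedge\bigvee_k b_k=\bigvee_k a\wedge b_k$ always holds. A *support* on $Q$ is a join-preserving map $\varsigma:Q\to Q$ with $\varsigma a\le e$, $\varsigma a\le aa^*$ and $a\le(\varsigma a)a$ for all $a$. A *partial unit* is an element $a$ with $aa^*\le e$ and $a^*a\le e$. $Q$ is an *inverse quantal frame* if it is a quantal frame, has a support, and $1$ is the join of the partial units. $Q$ is a *stable quantal frame* if it is a quantal frame such that $a1\wedge e\le aa^*$ and $a\le(a1\wedge e)a$ for all $a$; its support is then $\varsigma a=a1\wedge e$, with image $\varsigma Q=\{a\in Q: a\le e\}$. Let $Q\otimes_{\varsigma Q}Q$ be the tensor product of sup-lattices over $\varsigma Q$ (so that $ba\otimes c=b\otimes ac$ for $a\le e$), and let $\mu:Q\otimes_{\varsigma Q}Q\to Q$ be the join-preserving map with $\mu(a\otimes b)=ab$. $Q$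 is a *multiplicative quantal frame* if it is a stable quantal frame and the right adjoint $\mu_*$ of $\mu$ preserves arbitrary joins. For a locale map $f:X\to Y$ write $f^*$ for its inverse image frame homomorphism. The *localic category associated to* a multiplicative quantal frame $Q$ is the internal category in locales whose locale of units $G_0$ has frame $\varsigma Q$, whose locale of arrows $G_1$ has frame $Q$, and whose structure maps are given by $d^*(a)=a1$ (right adjoint to $\varsigma:Q\to\varsigma Q$), $u^*(a)=a\wedge e$, $r=d\circ i$ where $i:G_1\to G_1$ is given by $i^*(a)=a^*$, and $m^*=\mu_*$, where $m:G_1\times_{G_0}G_1\to G_1$ and the pullback $G_1\times_{G_0}G_1$ of $r$ and $d$ (pairs $(x,y)$ with $r(x)=d(y)$) has frame $Q\otimes_{\varsigma Q}Q$. An internal category is a *groupoid* if it has an inversion, that is, a map $j:G_1\to G_1$ with $d\circ j=r$, $r\circ j=d$, $m\circ\langle \mathrm{id},j\rangle=u\circ d$ and $m\circ\langle j,\mathrm{id}\rangle=u\circ r$. A localic groupoid is *étale* if $d$ is a local homeomorphism. Here a locale map $f:X\to Y$ is *open* if $f^*$ has a left adjoint $f_!$ with $f_!(a\wedge f^*(b))=f_!(a)\wedge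 b$ for all $a,b$, and a *local homeomorphism* if it is open and there is a set $C$ of elements of the frame of $X$ with $\bigvee C=1$ such that for each $a\in C$ the map $b\mapsto f^*(b)\wedge a$ is surjective onto $\{x: x\le a\}$. **Theorem.** For a unital involutive quantale $Q$ the following three conditions are equivalent. (i) $Q$ is an inverse quantal frame. (ii) $Q$ is a multiplicative quantal frame and its associated localic category is a groupoid. (iii) $Q$ is a multiplicative quantal frame and its associated localic category is an étale groupoid. Moreover, whenever $Q$ is a multiplicative quantal frame and its associated localic category is a groupoid, the map $i$ given by the involution of $Q$ is an inversion for it. -/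

import Mathlib

open CategoryTheory

set_option linter.unusedSectionVars false

universe u v w

namespace Quantal

/-! ### Internal categories and internal groupoids -/

/-- An internal category in `C`: objects of units and of arrows, domain `d`, range `r`, unit
inclusion `u`, and a multiplication `m` on the pullback `pairs` of `r` and `d` (the object of
composable pairs `(f, g)`, with `r f = d g`). The associativity law is stated on generalized
elements, which, when triple pullbacks exist (as in locales), is the usual diagram by Yoneda. -/
structure InternalCategory (C : Type v) [Category.{w} C] where
  units : C
  arrows : C
  pairs : C
  d : arrows ⟶ units
  r : arrows ⟶ units
  u : units ⟶ arrows
  π₁ : pairs ⟶ arrows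
  π₂ : pairs ⟶ arrows
  isPullback : IsPullback π₁ π₂ r d
  m : pairs ⟶ arrows
  u_d : u ≫ d = 𝟙 units
  u_r : u ≫ r = 𝟙 units
  m_d : m ≫ d = π₁ ≫ d
  m_r : m ≫ r = π₂ ≫ r
  unit_mul : isPullback.lift (d ≫ u) (𝟙 arrows)
    (by rw [Category.assoc, u_r, Category.comp_id, Category.id_comp]) ≫ m = 𝟙 arrows
  mul_unit : isPullback.lift (𝟙 arrows) (r ≫ u)
    (by rw [Category.assoc, u_d, Category.comp_id, Category.id_comp]) ≫ m = 𝟙 arrows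
  assoc : ∀ {X : C} (f g h : X ⟶ arrows) (hfg : f ≫ r = g ≫ d) (hgh : g ≫ r = h ≫ d),
    isPullback.lift (isPullback.lift f g hfg ≫ m) h
        (by rw [Category.assoc, m_r, IsPullback.lift_snd_assoc, hgh]) ≫ m =
      isPullback.lift f (isPullback.lift g h hgh ≫ m)
        (by rw [Category.assoc, m_d, IsPullback.lift_fst_assoc, hfg]) ≫ m

namespace InternalCategory

variable {C : Type v} [Category.{w} C] (G : InternalCategory C)

/-- `i` is an inversion morphism of `G`: it exchanges domain and range, and
`m ∘ ⟨id, i⟩ = u ∘ d`, `m ∘ ⟨i, id⟩ = u ∘ r`. -/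
structure IsInversion (i : G.arrows ⟶ G.arrows) : Prop where
  i_d : i ≫ G.d = G.r
  i_r : i ≫ G.r = G.d
  mul_inv : G.isPullback.lift (𝟙 G.arrows) i (by rw [Category.id_comp, i_d]) ≫ G.m = G.d ≫ G.u
  inv_mul : G.isPullback.lift i (𝟙 G.arrows) (by rw [Category.id_comp, i_r]) ≫ G.m = G.r ≫ G.u

/-- An internal category is an internal groupoid if it has an inversion morphism. -/
def IsGroupoid : Prop := ∃ i : G.arrows ⟶ G.arrows, G.IsInversion i

end InternalCategory

/-! ### Locale maps -/

/-- The inverse image frame homomorphism `f^*` of a locale map `f`. -/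
def inverseImage {X Y : Locale.{u}} (f : X ⟶ Y) : FrameHom Y X := Frm.Hom.hom f.unop

/-- The locale map whose inverse image is a given frame homomorphism. -/
def localeMap {X Y : Locale.{u}} (φ : FrameHom Y X) : X ⟶ Y := Quiver.Hom.op (Frm.ofHom φ)

theorem localeMap_ext {X Y : Locale.{u}} {f g : X ⟶ Y}
    (hfg : ∀ a : Y, inverseImage f a = inverseImage g a) : f = g :=
  Quiver.Hom.unop_inj (Frm.ext hfg)

theorem inverseImage_comp {X Y Z : Locale.{u}} (f : X ⟶ Y) (g : Y ⟶ Z) (a : Z) :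
    inverseImage (f ≫ g) a = inverseImage f (inverseImage g a) := rfl

theorem inverseImage_id {X : Locale.{u}} (a : X) : inverseImage (𝟙 X) a = a := rfl

/-- A locale map is open if its inverse image has a left adjoint (the direct image) which
satisfies the Frobenius reciprocity condition. -/
def IsOpenLocaleMap {X Y : Locale.{u}} (f : X ⟶ Y) : Prop :=
  ∃ directImage : X → Y, GaloisConnection directImage (inverseImage f) ∧
    ∀ (a : X) (b : Y), directImage (a ⊓ inverseImage f b) = directImage a ⊓ b

/-- A local homeomorphism of locales: an open map `f : X ⟶ Y` such that `X` has a cover by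
elements `a` for which `b ↦ f^*(b) ⊓ a` is surjective onto the down-segment of `a`. -/
def IsLocalHomeomorphism {X Y : Locale.{u}} (f : X ⟶ Y) : Prop :=
  IsOpenLocaleMap f ∧ ∃ cover : Set X, sSup cover = ⊤ ∧
    ∀ a ∈ cover, ∀ x ≤ a, ∃ b : Y, inverseImage f b ⊓ a = x

/-- A localic groupoid is étale if its domain map is a local homeomorphism. -/
def IsEtaleGroupoid (G : InternalCategory Locale.{u}) : Prop :=
  G.IsGroupoid ∧ IsLocalHomeomorphism G.d

/-! ### Quantales -/

/-- A quantale with involution: the involution `star` (which satisfies `star (star a) = a` and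
`star (a * b) = star b * star a`) preserves joins. -/
class IsInvolutiveQuantale (Q : Type u) [CompleteLattice Q] [Mul Q] [StarMul Q] : Prop where
  star_sSup : ∀ s : Set Q, star (sSup s) = ⨆ a ∈ s, star a

/-- Binary meets distribute over arbitrary joins. -/
def IsQuantalFrame (Q : Type u) [CompleteLattice Q] : Prop :=
  ∀ (a : Q) (s : Set Q), a ⊓ sSup s = ⨆ b ∈ s, a ⊓ b

section Supports

variable (Q : Type u) [CompleteLattice Q] [Monoid Q] [StarMul Q]

/-- A support: a join-preserving map `ς` with `ς a ≤ e`, `ς a ≤ a a^*` and `a ≤ (ς a) a`.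
The unit `e` of the quantale is `1`, and the top element is `⊤`. -/
structure IsSupport (ς : sSupHom Q Q) : Prop where
  le_one : ∀ a : Q, ς a ≤ 1
  le_mul_star : ∀ a : Q, ς a ≤ a * star a
  le_mul : ∀ a : Q, a ≤ ς a * a

/-- The set of partial units. -/
def partialUnits : Set Q := {a | a * star a ≤ 1 ∧ star a * a ≤ 1}

/-- An inverse quantal frame: a quantal frame with a support, whose top element is a join of
partial units. -/
structure IsInverseQuantalFrame : Prop where
  isQuantalFrame : IsQuantalFrame Q
  exists_support : ∃ ς : sSupHom Q Q, IsSupport Q ς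
  sSup_partialUnits : sSup (partialUnits Q) = ⊤

/-- A stable quantal frame. Its (unique) support is `ς a = a⊤ ⊓ e`, with `ςQ = ↓e`. -/
structure IsStableQuantalFrame : Prop where
  isQuantalFrame : IsQuantalFrame Q
  le_mul_star : ∀ a : Q, a * ⊤ ⊓ 1 ≤ a * star a
  le_mul : ∀ a : Q, a ≤ (a * ⊤ ⊓ 1) * a

end Supports

/-! ### The tensor product `Q ⊗ Q` over the down-segment of the unit -/

/-- The sup-lattice tensor product of `Q` with itself over the subquantale `↓e`, where `↓e` acts
by right multiplication on the left factor and by left multiplication on the right factor.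
Its elements are the sets of pairs which are downwards closed, closed under joins in each variable
separately, and for which `(b a, c)` is a member if and only if `(b, a c)` is, for all `a ≤ e`. -/
@[ext]
structure Tensor (Q : Type u) [CompleteLattice Q] [Monoid Q] where
  carrier : Set (Q × Q)
  lower : ∀ {a a' b b' : Q}, a' ≤ a → b' ≤ b → (a, b) ∈ carrier → (a', b') ∈ carrier
  sSup_left : ∀ (s : Set Q) (b : Q), (∀ a ∈ s, (a, b) ∈ carrier) → (sSup s, b) ∈ carrier
  sSup_right : ∀ (a : Q) (s : Set Q), (∀ b ∈ s, (a, b) ∈ carrier) → (a, sSup s) ∈ carrier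
  balanced : ∀ a b c : Q, a ≤ 1 → ((b * a, c) ∈ carrier ↔ (b, a * c) ∈ carrier)

namespace Tensor

variable {Q : Type u} [CompleteLattice Q] [Monoid Q]

instance : PartialOrder (Tensor Q) :=
  PartialOrder.lift Tensor.carrier (fun _ _ h => Tensor.ext h)

theorem le_def {U V : Tensor Q} : U ≤ V ↔ U.carrier ⊆ V.carrier := Iff.rfl

instance : InfSet (Tensor Q) where
  sInf S :=
    { carrier := {p | ∀ U ∈ S, p ∈ U.carrier}
      lower := fun h₁ h₂ h U hU => U.lower h₁ h₂ (h U hU)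
      sSup_left := fun s b h U hU => U.sSup_left s b (fun a ha => h a ha U hU)
      sSup_right := fun a s h U hU => U.sSup_right a s (fun b hb => h b hb U hU)
      balanced := fun a b c ha =>
        ⟨fun h U hU => (U.balanced a b c ha).1 (h U hU),
          fun h U hU => (U.balanced a b c ha).2 (h U hU)⟩ }

instance : CompleteLattice (Tensor Q) :=
  completeLatticeOfInf (Tensor Q) (fun _ =>
    ⟨fun U hU _ hp => hp U hU, fun _ hV _ hp _ hU => hV hU hp⟩)

/-- The pure tensor `a ⊗ b`. -/
def tmul (a b : Q) : Tensor Q := sInf {U | (a, b) ∈ U.carrier}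

theorem mem_tmul (a b : Q) : (a, b) ∈ (tmul a b).carrier := fun _ hU => hU

theorem tmul_le {a b : Q} {U : Tensor Q} : tmul a b ≤ U ↔ (a, b) ∈ U.carrier :=
  ⟨fun h => h (mem_tmul a b), fun h _ hp => hp U h⟩

theorem tmul_mono {a b a' b' : Q} (h : a ≤ a') (h' : b ≤ b') : tmul a b ≤ tmul a' b' :=
  tmul_le.2 ((tmul a' b').lower h h' (mem_tmul a' b'))

theorem tmul_balanced {a : Q} (ha : a ≤ 1) (b c : Q) : tmul (b * a) c = tmul b (a * c) :=
  le_antisymm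
    (tmul_le.2 (((tmul b (a * c)).balanced a b c ha).2 (mem_tmul _ _)))
    (tmul_le.2 (((tmul (b * a) c).balanced a b c ha).1 (mem_tmul _ _)))

theorem mem_inf {U V : Tensor Q} {p : Q × Q} :
    p ∈ (U ⊓ V).carrier ↔ p ∈ U.carrier ∧ p ∈ V.carrier := by
  constructor
  · intro h
    exact ⟨(inf_le_left : U ⊓ V ≤ U) h, (inf_le_right : U ⊓ V ≤ V) h⟩
  · rintro ⟨h₁, h₂⟩
    exact (le_inf (tmul_le.2 h₁) (tmul_le.2 h₂) : tmul p.1 p.2 ≤ U ⊓ V) (mem_tmul _ _)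

/-- A map preserving joins in each variable which is balanced over `↓e`. -/
structure IsBalancedBimorphism {N : Type v} [CompleteLattice N] (f : Q → Q → N) : Prop where
  map_sSup_left : ∀ (s : Set Q) (b : Q), f (sSup s) b = ⨆ a ∈ s, f a b
  map_sSup_right : ∀ (a : Q) (s : Set Q), f a (sSup s) = ⨆ b ∈ s, f a b
  balanced : ∀ a b c : Q, a ≤ 1 → f (b * a) c = f b (a * c)


theorem IsBalancedBimorphism.mono {N : Type v} [CompleteLattice N] {f : Q → Q → N}
    (hf : IsBalancedBimorphism f) {a a' b b' : Q} (ha : a ≤ a') (hb : b ≤ b') :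
    f a b ≤ f a' b' := by
  have h₁ : f a b ≤ f a' b := by
    have h := hf.map_sSup_left {a, a'} b
    rw [sSup_pair, sup_eq_right.2 ha] at h
    rw [h]
    exact le_iSup₂_of_le a (by simp) le_rfl
  have h₂ : f a' b ≤ f a' b' := by
    have h := hf.map_sSup_right a' {b, b'}
    rw [sSup_pair, sup_eq_right.2 hb] at h
    rw [h]
    exact le_iSup₂_of_le b (by simp) le_rfl
  exact h₁.trans h₂

/-- The right adjoint of the homomorphism induced by a balanced bimorphism. -/
def rightAdjoint {N : Type v} [CompleteLattice N] {f : Q → Q → N}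
    (hf : IsBalancedBimorphism f) (x : N) : Tensor Q where
  carrier := {p | f p.1 p.2 ≤ x}
  lower := fun h₁ h₂ h => (hf.mono h₁ h₂).trans h
  sSup_left := fun s b h => by
    rw [Set.mem_ofPred_eq, hf.map_sSup_left]
    exact iSup₂_le h
  sSup_right := fun a s h => by
    rw [Set.mem_ofPred_eq, hf.map_sSup_right]
    exact iSup₂_le h
  balanced := fun a b c ha => by
    rw [Set.mem_ofPred_eq, Set.mem_ofPred_eq, hf.balanced a b c ha]

theorem gc_rightAdjoint {N : Type v} [CompleteLattice N] {f : Q → Q → N}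
    (hf : IsBalancedBimorphism f) :
    GaloisConnection (fun U : Tensor Q => ⨆ p ∈ U.carrier, f p.1 p.2) (rightAdjoint hf) :=
  fun _ _ => iSup₂_le_iff

/-- The sup-lattice homomorphism on the tensor product induced by a balanced bimorphism `f`,
given on pure tensors by `a ⊗ b ↦ f a b`. -/
def lift {N : Type v} [CompleteLattice N] {f : Q → Q → N}
    (hf : IsBalancedBimorphism f) : sSupHom (Tensor Q) N where
  toFun U := ⨆ p ∈ U.carrier, f p.1 p.2
  map_sSup' S := by
    rw [(gc_rightAdjoint hf).l_sSup, sSup_image]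

theorem lift_apply {N : Type v} [CompleteLattice N] {f : Q → Q → N}
    (hf : IsBalancedBimorphism f) (U : Tensor Q) :
    lift hf U = ⨆ p ∈ U.carrier, f p.1 p.2 := rfl

theorem lift_tmul {N : Type v} [CompleteLattice N] {f : Q → Q → N}
    (hf : IsBalancedBimorphism f) (a b : Q) : lift hf (tmul a b) = f a b := by
  apply le_antisymm
  · exact (gc_rightAdjoint hf _ _).2 (tmul_le.2 (le_refl (f a b)))
  · exact le_iSup₂_of_le (a, b) (mem_tmul a b) le_rfl

theorem eq_iSup_tmul (U : Tensor Q) : U = ⨆ p ∈ U.carrier, tmul p.1 p.2 :=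
  le_antisymm
    (fun p hp => (le_iSup₂_of_le p hp le_rfl :
      tmul p.1 p.2 ≤ ⨆ p ∈ U.carrier, tmul p.1 p.2) (mem_tmul p.1 p.2))
    (iSup₂_le fun _ hp => tmul_le.2 hp)

theorem isBalancedBimorphism_mul [IsQuantale Q] :
    IsBalancedBimorphism (fun a b : Q => a * b) where
  map_sSup_left _ _ := sSup_mul_distrib
  map_sSup_right _ _ := mul_sSup_distrib
  balanced a b c _ := mul_assoc b a c

/-- The quantal multiplication `μ`, with `μ (a ⊗ b) = a b`. -/
def mulHom (Q : Type u) [CompleteLattice Q] [Monoid Q] [IsQuantale Q] : sSupHom (Tensor Q) Q :=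
  lift isBalancedBimorphism_mul

/-- The right adjoint `μ_*` of the quantal multiplication. -/
def mulRightAdjoint [IsQuantale Q] (a : Q) : Tensor Q := rightAdjoint isBalancedBimorphism_mul a

theorem gc_mul [IsQuantale Q] : GaloisConnection (mulHom Q) (mulRightAdjoint (Q := Q)) :=
  gc_rightAdjoint isBalancedBimorphism_mul

theorem mem_mulRightAdjoint [IsQuantale Q] {a x y : Q} :
    (x, y) ∈ (mulRightAdjoint a).carrier ↔ x * y ≤ a := Iff.rfl

end Tensor

/-- A multiplicative quantal frame: a stable quantal frame for which the right adjoint of the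
quantal multiplication preserves arbitrary joins. -/
structure IsMultiplicativeQuantalFrame (Q : Type u) [CompleteLattice Q] [Monoid Q] [IsQuantale Q]
    [StarMul Q] : Prop extends IsStableQuantalFrame Q where
  mulRightAdjoint_sSup : ∀ s : Set Q,
    Tensor.mulRightAdjoint (sSup s) = ⨆ a ∈ s, Tensor.mulRightAdjoint a

/-! ### Facts on stable quantal frames -/

section Basic

variable {Q : Type u} [CompleteLattice Q] [Monoid Q] [IsQuantale Q]

theorem mul_le_mul'' {a a' b b' : Q} (ha : a ≤ a') (hb : b ≤ b') : a * b ≤ a' * b' :=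
  Tensor.isBalancedBimorphism_mul.mono ha hb

variable [StarMul Q] [IsInvolutiveQuantale Q]

theorem star_mono {a b : Q} (h : a ≤ b) : star a ≤ star b := by
  have h' := IsInvolutiveQuantale.star_sSup ({a, b} : Set Q)
  rw [sSup_pair, sup_eq_right.2 h] at h'
  rw [h']
  exact le_iSup₂_of_le a (by simp) le_rfl

theorem star_le_iff {a b : Q} : star a ≤ b ↔ a ≤ star b :=
  ⟨fun h => by simpa using star_mono h, fun h => by simpa using star_mono h⟩

theorem star_top' : star (⊤ : Q) = ⊤ := top_le_iff.1 (star_le_iff.1 le_top)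

theorem star_inf' (a b : Q) : star (a ⊓ b) = star a ⊓ star b :=
  le_antisymm (le_inf (star_mono inf_le_left) (star_mono inf_le_right))
    (star_le_iff.1 (le_inf (star_le_iff.2 inf_le_left) (star_le_iff.2 inf_le_right)))

end Basic

namespace IsStableQuantalFrame

variable {Q : Type u} [CompleteLattice Q] [Monoid Q] [IsQuantale Q] [StarMul Q]
  [IsInvolutiveQuantale Q] (h : IsStableQuantalFrame Q)

theorem star_le_one {a : Q} (ha : a ≤ 1) : star a ≤ 1 := by
  simpa using star_mono ha

theorem mul_top_inf_one (h : IsStableQuantalFrame Q) {a : Q} (ha : a ≤ 1) : a * ⊤ ⊓ 1 = a := by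
  apply le_antisymm
  · calc a * ⊤ ⊓ 1 ≤ a * star a := h.le_mul_star a
      _ ≤ a * 1 := mul_le_mul'' le_rfl (star_le_one ha)
      _ = a := mul_one a
  · exact le_inf (by simpa using mul_le_mul'' (le_refl a) (le_top : (1 : Q) ≤ ⊤)) ha

theorem mul_top_inf (h : IsStableQuantalFrame Q) {a : Q} (ha : a ≤ 1) (c : Q) :
    a * ⊤ ⊓ c = a * c := by
  apply le_antisymm
  · calc a * ⊤ ⊓ c ≤ ((a * ⊤ ⊓ c) * ⊤ ⊓ 1) * (a * ⊤ ⊓ c) := h.le_mul _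
      _ ≤ (a * ⊤ ⊓ 1) * c := by
        refine mul_le_mul'' (inf_le_inf_right _ ?_) inf_le_right
        calc (a * ⊤ ⊓ c) * ⊤ ≤ (a * ⊤) * ⊤ := mul_le_mul'' inf_le_left le_rfl
          _ = a * (⊤ * ⊤) := mul_assoc _ _ _
          _ ≤ a * ⊤ := mul_le_mul'' le_rfl le_top
      _ = a * c := by rw [h.mul_top_inf_one ha]
  · refine le_inf (mul_le_mul'' le_rfl le_top) ?_
    simpa using mul_le_mul'' ha (le_refl c)

theorem star_eq (h : IsStableQuantalFrame Q) {a : Q} (ha : a ≤ 1) : star a = a := by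
  have key : ∀ {b : Q}, b ≤ 1 → b ≤ star b := fun {b} hb => by
    calc b = b * ⊤ ⊓ 1 := (h.mul_top_inf_one hb).symm
      _ ≤ b * star b := h.le_mul_star b
      _ ≤ 1 * star b := mul_le_mul'' hb le_rfl
      _ = star b := one_mul _
  exact le_antisymm (by simpa using key (star_le_one ha)) (key ha)

theorem star_mul_top (h : IsStableQuantalFrame Q) {a : Q} (ha : a ≤ 1) :
    star (a * ⊤) = ⊤ * a := by
  rw [star_mul, star_top', h.star_eq ha]

theorem top_mul_inf (h : IsStableQuantalFrame Q) {a : Q} (ha : a ≤ 1) (c : Q) :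
    ⊤ * a ⊓ c = c * a := by
  have := congrArg star (h.mul_top_inf ha (star c))
  rwa [star_inf', h.star_mul_top ha, star_star, star_mul, star_star, h.star_eq ha] at this

theorem inf_mul_right (h : IsStableQuantalFrame Q) {a : Q} (ha : a ≤ 1) (b x : Q) :
    b * a ⊓ x = (b ⊓ x) * a := by
  rw [← h.top_mul_inf ha b, ← h.top_mul_inf ha (b ⊓ x), inf_assoc]

theorem inf_mul_left (h : IsStableQuantalFrame Q) {a : Q} (ha : a ≤ 1) (b x : Q) :
    a * b ⊓ x = a * (b ⊓ x) := by
  rw [← h.mul_top_inf ha b, ← h.mul_top_inf ha (b ⊓ x), inf_assoc]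

theorem inf_eq_mul (h : IsStableQuantalFrame Q) {a b : Q} (ha : a ≤ 1) (hb : b ≤ 1) :
    a ⊓ b = a * b := by
  apply le_antisymm
  · rw [← h.mul_top_inf ha b]
    exact inf_le_inf_right _ (by simpa using mul_le_mul'' (le_refl a) (le_top : (1 : Q) ≤ ⊤))
  · exact le_inf (by simpa using mul_le_mul'' (le_refl a) hb)
      (by simpa using mul_le_mul'' ha (le_refl b))

/-- The range of the support `a ↦ a⊤ ⊓ e` is the down-segment of `e`. -/
theorem range_support (h : IsStableQuantalFrame Q) :
    Set.range (fun a : Q => a * ⊤ ⊓ 1) = Set.Iic 1 := by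
  ext b
  constructor
  · rintro ⟨a, rfl⟩
    exact inf_le_right
  · intro hb
    exact ⟨b, h.mul_top_inf_one hb⟩

theorem sSup_inf_eq' (h : IsStableQuantalFrame Q) (s : Set Q) (a : Q) :
    sSup s ⊓ a = ⨆ b ∈ s, b ⊓ a := by
  rw [inf_comm, h.isQuantalFrame]
  simp only [inf_comm]

/-! ### The locales of arrows, of units and of composable pairs -/

/-- A stable quantal frame, as a frame. -/
@[reducible]
def frame (h : IsStableQuantalFrame Q) : Order.Frame Q :=
  Order.Frame.ofMinimalAxioms ⟨fun a s => (h.isQuantalFrame a s).le⟩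

/-- The frame structure of `ςQ = ↓e`. -/
@[reducible]
def frameUnits (h : IsStableQuantalFrame Q) : Order.Frame (Set.Iic (1 : Q)) :=
  Order.Frame.ofMinimalAxioms ⟨fun a s => by
    change (a : Q) ⊓ sSup (Subtype.val '' s) ≤ _
    rw [h.isQuantalFrame]
    refine iSup₂_le ?_
    rintro _ ⟨b, hb, rfl⟩
    exact (le_iSup₂_of_le b hb le_rfl : a ⊓ b ≤ ⨆ b ∈ s, a ⊓ b)⟩

/-- The largest `W` such that `p ⊓ q ∈ V` for all `p ∈ W` and all `q` in a given set. -/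
def himpTensor (h : IsStableQuantalFrame Q) (S : Set (Q × Q)) (V : Tensor Q) : Tensor Q where
  carrier := {p | ∀ q ∈ S, (p.1 ⊓ q.1, p.2 ⊓ q.2) ∈ V.carrier}
  lower := fun h₁ h₂ hp q hq => V.lower (inf_le_inf_right _ h₁) (inf_le_inf_right _ h₂) (hp q hq)
  sSup_left := fun s b hs q hq => by
    change (sSup s ⊓ q.1, b ⊓ q.2) ∈ V.carrier
    rw [h.sSup_inf_eq', ← sSup_image]
    refine V.sSup_left _ _ ?_
    rintro _ ⟨a, ha, rfl⟩
    exact hs a ha q hq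
  sSup_right := fun a s hs q hq => by
    change (a ⊓ q.1, sSup s ⊓ q.2) ∈ V.carrier
    rw [h.sSup_inf_eq', ← sSup_image]
    refine V.sSup_right _ _ ?_
    rintro _ ⟨b, hb, rfl⟩
    exact hs b hb q hq
  balanced := fun a b c ha => by
    refine forall₂_congr fun q _ => ?_
    change (b * a ⊓ q.1, c ⊓ q.2) ∈ V.carrier ↔ (b ⊓ q.1, a * c ⊓ q.2) ∈ V.carrier
    rw [h.inf_mul_right ha, h.inf_mul_left ha]
    exact V.balanced a _ _ ha

/-- The frame structure of the tensor product. -/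
@[reducible]
def frameTensor (h : IsStableQuantalFrame Q) : Order.Frame (Tensor Q) :=
  Order.Frame.ofMinimalAxioms ⟨fun U S => by
    have key : sSup S ≤ h.himpTensor U.carrier (⨆ V ∈ S, U ⊓ V) := by
      refine sSup_le fun V hV p hp q hq => ?_
      have hle : U ⊓ V ≤ ⨆ V ∈ S, U ⊓ V := le_iSup₂_of_le V hV le_rfl
      exact hle (Tensor.mem_inf.2
        ⟨U.lower inf_le_right inf_le_right hq, V.lower inf_le_left inf_le_left hp⟩)
    intro p hp
    obtain ⟨h₁, h₂⟩ := Tensor.mem_inf.1 hp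
    simpa using key h₂ p h₁⟩

theorem tmul_inf_tmul (h : IsStableQuantalFrame Q) (a b : Q) :
    Tensor.tmul a ⊤ ⊓ Tensor.tmul ⊤ b = Tensor.tmul a b := by
  apply le_antisymm
  · have h₁ : Tensor.tmul ⊤ b ≤ h.himpTensor {(a, ⊤)} (Tensor.tmul a b) := by
      refine Tensor.tmul_le.2 ?_
      rintro _ rfl
      simpa using Tensor.mem_tmul a b
    have h₂ : Tensor.tmul a ⊤ ≤
        h.himpTensor (Tensor.tmul ⊤ b).carrier (Tensor.tmul a b) := by
      refine Tensor.tmul_le.2 ?_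
      intro q hq
      have := h₁ hq _ rfl
      simpa [inf_comm] using this
    intro p hp
    obtain ⟨hp₁, hp₂⟩ := Tensor.mem_inf.1 hp
    simpa using h₂ hp₁ p hp₂
  · exact le_inf (Tensor.tmul_mono le_rfl le_top) (Tensor.tmul_mono le_top le_rfl)

/-- The locale of arrows `G₁`, whose frame is `Q`. -/
def arrows (h : IsStableQuantalFrame Q) : Locale.{u} := @Locale.of Q h.frame

/-- The locale of units `G₀`, whose frame is `ςQ = ↓e`. -/
def units (h : IsStableQuantalFrame Q) : Locale.{u} := @Locale.of (Set.Iic (1 : Q)) h.frameUnits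

/-- The locale of composable pairs, whose frame is the tensor product of `Q` with itself over
`ςQ`. -/
def pairs (h : IsStableQuantalFrame Q) : Locale.{u} := @Locale.of (Tensor Q) h.frameTensor

/-! ### The structure maps -/

/-- The inverse image `a ↦ a⊤` of the domain map. It is right adjoint to the support
`a ↦ a⊤ ⊓ e`. -/
def dHom (h : IsStableQuantalFrame Q) : FrameHom (Set.Iic (1 : Q)) Q where
  toFun a := (a : Q) * ⊤
  map_inf' a b := by
    change ((a : Q) ⊓ b) * ⊤ = (a : Q) * ⊤ ⊓ (b : Q) * ⊤
    rw [h.inf_eq_mul a.2 b.2, h.mul_top_inf a.2, mul_assoc]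
  map_top' := one_mul (⊤ : Q)
  map_sSup' s := by
    change sSup (Subtype.val '' s) * ⊤ = _
    rw [sSup_mul_distrib, sSup_image, iSup_image]

theorem gc_support_dHom (h : IsStableQuantalFrame Q) :
    GaloisConnection (fun a : Q => (⟨a * ⊤ ⊓ 1, inf_le_right⟩ : Set.Iic (1 : Q))) h.dHom := by
  intro a b
  change a * ⊤ ⊓ 1 ≤ (b : Q) ↔ a ≤ b * ⊤
  constructor
  · intro hab
    exact (h.le_mul a).trans (mul_le_mul'' hab le_top)
  · intro hab
    rw [← h.mul_top_inf_one b.2]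
    refine inf_le_inf_right _ ?_
    calc a * ⊤ ≤ (b * ⊤) * ⊤ := mul_le_mul'' hab le_rfl
      _ = b * (⊤ * ⊤) := mul_assoc _ _ _
      _ ≤ b * ⊤ := mul_le_mul'' le_rfl le_top

/-- The inverse image `a ↦ a ⊓ e` of the unit inclusion. -/
def uHom (h : IsStableQuantalFrame Q) : FrameHom Q (Set.Iic (1 : Q)) where
  toFun a := ⟨a ⊓ 1, inf_le_right⟩
  map_inf' a b := Subtype.ext (inf_inf_distrib_right a b 1)
  map_top' := Subtype.ext (top_inf_eq (1 : Q))
  map_sSup' s := Subtype.ext (by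
    change sSup s ⊓ 1 = sSup (Subtype.val '' _)
    rw [h.sSup_inf_eq', sSup_image, iSup_image])

/-- The involution as a frame homomorphism. -/
def iHom (_h : IsStableQuantalFrame Q) : FrameHom Q Q where
  toFun := star
  map_inf' := star_inf'
  map_top' := star_top'
  map_sSup' s := by rw [IsInvolutiveQuantale.star_sSup, sSup_image]

/-- The inverse image `a ↦ a ⊗ ⊤` of the first projection. -/
def fstHom (h : IsStableQuantalFrame Q) : FrameHom Q (Tensor Q) where
  toFun a := Tensor.tmul a ⊤
  map_inf' a b := by
    apply le_antisymm
    · exact le_inf (Tensor.tmul_mono inf_le_left le_rfl) (Tensor.tmul_mono inf_le_right le_rfl)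
    · have h₁ : Tensor.tmul b ⊤ ≤ h.himpTensor {(a, ⊤)} (Tensor.tmul (a ⊓ b) ⊤) := by
        refine Tensor.tmul_le.2 ?_
        rintro _ rfl
        simpa [inf_comm] using Tensor.mem_tmul (a ⊓ b) ⊤
      have h₂ : Tensor.tmul a ⊤ ≤
          h.himpTensor (Tensor.tmul b ⊤).carrier (Tensor.tmul (a ⊓ b) ⊤) := by
        refine Tensor.tmul_le.2 ?_
        intro q hq
        simpa [inf_comm] using h₁ hq _ rfl
      intro p hp
      obtain ⟨hp₁, hp₂⟩ := Tensor.mem_inf.1 hp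
      simpa using h₂ hp₁ p hp₂
  map_top' := top_le_iff.1 fun p _ => (Tensor.tmul ⊤ ⊤).lower le_top le_top (Tensor.mem_tmul _ _)
  map_sSup' s := by
    rw [sSup_image]
    apply le_antisymm
    · refine Tensor.tmul_le.2 (Tensor.sSup_left _ _ _ fun a ha => ?_)
      exact (le_iSup₂_of_le a ha le_rfl :
        Tensor.tmul a ⊤ ≤ ⨆ a ∈ s, Tensor.tmul a ⊤) (Tensor.mem_tmul _ _)
    · exact iSup₂_le fun a ha => Tensor.tmul_mono (le_sSup ha) le_rfl

/-- The inverse image `a ↦ ⊤ ⊗ a` of the second projection. -/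
def sndHom (h : IsStableQuantalFrame Q) : FrameHom Q (Tensor Q) where
  toFun a := Tensor.tmul ⊤ a
  map_inf' a b := by
    apply le_antisymm
    · exact le_inf (Tensor.tmul_mono le_rfl inf_le_left) (Tensor.tmul_mono le_rfl inf_le_right)
    · have h₁ : Tensor.tmul ⊤ b ≤ h.himpTensor {(⊤, a)} (Tensor.tmul ⊤ (a ⊓ b)) := by
        refine Tensor.tmul_le.2 ?_
        rintro _ rfl
        simpa [inf_comm] using Tensor.mem_tmul ⊤ (a ⊓ b)
      have h₂ : Tensor.tmul ⊤ a ≤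
          h.himpTensor (Tensor.tmul ⊤ b).carrier (Tensor.tmul ⊤ (a ⊓ b)) := by
        refine Tensor.tmul_le.2 ?_
        intro q hq
        simpa [inf_comm] using h₁ hq _ rfl
      intro p hp
      obtain ⟨hp₁, hp₂⟩ := Tensor.mem_inf.1 hp
      simpa using h₂ hp₁ p hp₂
  map_top' := top_le_iff.1 fun p _ => (Tensor.tmul ⊤ ⊤).lower le_top le_top (Tensor.mem_tmul _ _)
  map_sSup' s := by
    rw [sSup_image]
    apply le_antisymm
    · refine Tensor.tmul_le.2 (Tensor.sSup_right _ _ _ fun a ha => ?_)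
      exact (le_iSup₂_of_le a ha le_rfl :
        Tensor.tmul ⊤ a ≤ ⨆ a ∈ s, Tensor.tmul ⊤ a) (Tensor.mem_tmul _ _)
    · exact iSup₂_le fun a ha => Tensor.tmul_mono le_rfl (le_sSup ha)

theorem isBalancedBimorphism_pair (h : IsStableQuantalFrame Q) {L : Type v} [Order.Frame L]
    (f g : FrameHom Q L) (hfg : ∀ a : Q, a ≤ 1 → f (⊤ * a) = g (a * ⊤)) :
    Tensor.IsBalancedBimorphism (fun a b : Q => f a ⊓ g b) where
  map_sSup_left s b := by
    change f (sSup s) ⊓ g b = ⨆ a ∈ s, f a ⊓ g b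
    rw [map_sSup, sSup_image, iSup₂_inf_eq]
  map_sSup_right a s := by
    change f a ⊓ g (sSup s) = ⨆ b ∈ s, f a ⊓ g b
    rw [map_sSup, sSup_image, inf_iSup₂_eq]
  balanced a b c ha := by
    rw [← h.top_mul_inf ha, ← h.mul_top_inf ha, map_inf, map_inf, hfg a ha,
      inf_comm (g (a * ⊤)) (f b), inf_assoc, inf_comm (g (a * ⊤)) (g c)]

/-- The frame homomorphism `[f, g]`, with `a ⊗ b ↦ f a ⊓ g b`. -/
def pairHom (h : IsStableQuantalFrame Q) {L : Type v} [Order.Frame L]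
    (f g : FrameHom Q L) (hfg : ∀ a : Q, a ≤ 1 → f (⊤ * a) = g (a * ⊤)) :
    FrameHom (Tensor Q) L where
  toFun := Tensor.lift (h.isBalancedBimorphism_pair f g hfg)
  map_inf' U V := by
    apply le_antisymm
    · exact le_inf (OrderHomClass.mono _ inf_le_left) (OrderHomClass.mono _ inf_le_right)
    · simp only [Tensor.lift_apply]
      rw [iSup₂_inf_eq]
      refine iSup₂_le fun p hp => ?_
      rw [inf_iSup₂_eq]
      refine iSup₂_le fun q hq => ?_
      refine le_iSup₂_of_le (p.1 ⊓ q.1, p.2 ⊓ q.2) (Tensor.mem_inf.2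
        ⟨U.lower inf_le_left inf_le_left hp, V.lower inf_le_right inf_le_right hq⟩) ?_
      rw [map_inf, map_inf]
      exact le_of_eq (by ac_rfl)
  map_top' := top_le_iff.1 (le_iSup₂_of_le (⊤, ⊤)
    ((le_top : Tensor.tmul ⊤ ⊤ ≤ (⊤ : Tensor Q)) (Tensor.mem_tmul _ _)) (by simp))
  map_sSup' S := by rw [map_sSup]

theorem pairHom_apply (h : IsStableQuantalFrame Q) {L : Type v} [Order.Frame L]
    (f g : FrameHom Q L) (hfg : ∀ a : Q, a ≤ 1 → f (⊤ * a) = g (a * ⊤)) (U : Tensor Q) :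
    h.pairHom f g hfg U = ⨆ p ∈ U.carrier, f p.1 ⊓ g p.2 := rfl

theorem pairHom_tmul (h : IsStableQuantalFrame Q) {L : Type v} [Order.Frame L]
    (f g : FrameHom Q L) (hfg : ∀ a : Q, a ≤ 1 → f (⊤ * a) = g (a * ⊤)) (a b : Q) :
    h.pairHom f g hfg (Tensor.tmul a b) = f a ⊓ g b :=
  Tensor.lift_tmul (h.isBalancedBimorphism_pair f g hfg) a b

/-- The domain map. -/
def d (h : IsStableQuantalFrame Q) : h.arrows ⟶ h.units := @localeMap h.arrows h.units h.dHom

/-- The unit inclusion map. -/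
def u (h : IsStableQuantalFrame Q) : h.units ⟶ h.arrows := @localeMap h.units h.arrows h.uHom

/-- The locale map `i` given by the involution of `Q`. -/
def i (h : IsStableQuantalFrame Q) : h.arrows ⟶ h.arrows := @localeMap h.arrows h.arrows h.iHom

/-- The range map. -/
def r (h : IsStableQuantalFrame Q) : h.arrows ⟶ h.units := h.i ≫ h.d

/-- The first projection. -/
def π₁ (h : IsStableQuantalFrame Q) : h.pairs ⟶ h.arrows := @localeMap h.pairs h.arrows h.fstHom

/-- The second projection. -/
def π₂ (h : IsStableQuantalFrame Q) : h.pairs ⟶ h.arrows := @localeMap h.pairs h.arrows h.sndHom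

/-! ### The pullback property -/

theorem fst_r_eq_snd_d (h : IsStableQuantalFrame Q) : h.π₁ ≫ h.r = h.π₂ ≫ h.d := by
  refine localeMap_ext fun a => ?_
  obtain ⟨a, ha⟩ : Set.Iic (1 : Q) := a
  change Tensor.tmul (star (a * ⊤)) ⊤ = Tensor.tmul ⊤ (a * ⊤)
  rw [h.star_mul_top ha]
  exact Tensor.tmul_balanced ha _ _

theorem compat (h : IsStableQuantalFrame Q) {X : Locale.{u}} {f g : X ⟶ h.arrows}
    (w : f ≫ h.r = g ≫ h.d) (a : Q) (ha : a ≤ 1) :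
    (inverseImage f : FrameHom Q X) (⊤ * a) = (inverseImage g : FrameHom Q X) (a * ⊤) := by
  have := congrArg (fun k : X ⟶ h.units => inverseImage k (⟨a, ha⟩ : Set.Iic (1 : Q))) w
  change inverseImage f (star (a * ⊤) : Q) = inverseImage g (a * ⊤ : Q) at this
  rwa [h.star_mul_top ha] at this

/-- The locale map `⟨f, g⟩` into the locale of composable pairs. -/
def pairMap (h : IsStableQuantalFrame Q) {X : Locale.{u}} (f g : X ⟶ h.arrows)
    (w : f ≫ h.r = g ≫ h.d) : X ⟶ h.pairs :=
  @localeMap X h.pairs (h.pairHom (inverseImage f) (inverseImage g) (h.compat w))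

theorem pairMap_apply (h : IsStableQuantalFrame Q) {X : Locale.{u}} (f g : X ⟶ h.arrows)
    (w : f ≫ h.r = g ≫ h.d) (U : Tensor Q) :
    (inverseImage (h.pairMap f g w) : FrameHom (Tensor Q) X) U =
      ⨆ p ∈ U.carrier, inverseImage f (p.1 : Q) ⊓ inverseImage g (p.2 : Q) := rfl

theorem pairMap_fst (h : IsStableQuantalFrame Q) {X : Locale.{u}} (f g : X ⟶ h.arrows)
    (w : f ≫ h.r = g ≫ h.d) : h.pairMap f g w ≫ h.π₁ = f := by
  refine localeMap_ext fun a => ?_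
  refine (h.pairHom_tmul (inverseImage f) (inverseImage g) (h.compat w) a ⊤).trans ?_
  exact (congrArg (inverseImage f a ⊓ ·) (map_top (inverseImage g))).trans (inf_top_eq _)

theorem pairMap_snd (h : IsStableQuantalFrame Q) {X : Locale.{u}} (f g : X ⟶ h.arrows)
    (w : f ≫ h.r = g ≫ h.d) : h.pairMap f g w ≫ h.π₂ = g := by
  refine localeMap_ext fun a => ?_
  refine (h.pairHom_tmul (inverseImage f) (inverseImage g) (h.compat w) ⊤ a).trans ?_
  exact (congrArg (· ⊓ inverseImage g a) (map_top (inverseImage f))).trans (top_inf_eq _)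

theorem pairs_hom_ext (h : IsStableQuantalFrame Q) {X : Locale.{u}} {k l : X ⟶ h.pairs}
    (h₁ : k ≫ h.π₁ = l ≫ h.π₁) (h₂ : k ≫ h.π₂ = l ≫ h.π₂) : k = l := by
  refine localeMap_ext fun U => ?_
  let φ : FrameHom (Tensor Q) X := inverseImage k
  let ψ : FrameHom (Tensor Q) X := inverseImage l
  have e₁ : ∀ a : Q, φ (Tensor.tmul a ⊤) = ψ (Tensor.tmul a ⊤) := fun a =>
    congrArg (fun k : X ⟶ h.arrows => (inverseImage k : FrameHom Q X) a) h₁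
  have e₂ : ∀ a : Q, φ (Tensor.tmul ⊤ a) = ψ (Tensor.tmul ⊤ a) := fun a =>
    congrArg (fun k : X ⟶ h.arrows => (inverseImage k : FrameHom Q X) a) h₂
  have key : ∀ U : Tensor Q, φ U = ψ U := fun U => by
    rw [Tensor.eq_iSup_tmul U, map_iSup₂, map_iSup₂]
    refine iSup_congr fun p => iSup_congr fun _ => ?_
    rw [← h.tmul_inf_tmul, map_inf, map_inf, e₁, e₂]
  exact key U

/-- The locale of composable pairs is the pullback of `r` and `d`. -/
theorem isPullback (h : IsStableQuantalFrame Q) : IsPullback h.π₁ h.π₂ h.r h.d :=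
  ⟨⟨h.fst_r_eq_snd_d⟩, ⟨Limits.PullbackCone.IsLimit.mk _
    (fun s => h.pairMap s.fst s.snd s.condition)
    (fun _ => h.pairMap_fst _ _ _) (fun _ => h.pairMap_snd _ _ _)
    (fun _ _ h₁ h₂ => h.pairs_hom_ext (h₁.trans (h.pairMap_fst _ _ _).symm)
      (h₂.trans (h.pairMap_snd _ _ _).symm))⟩⟩

end IsStableQuantalFrame

/-! ### The localic category of a multiplicative quantal frame -/

namespace IsMultiplicativeQuantalFrame

variable {Q : Type u} [CompleteLattice Q] [Monoid Q] [IsQuantale Q] [StarMul Q]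
  [IsInvolutiveQuantale Q]

/-- The right adjoint of the quantal multiplication as a frame homomorphism. -/
def mHom (h : IsMultiplicativeQuantalFrame Q) : FrameHom Q (Tensor Q) where
  toFun := Tensor.mulRightAdjoint
  map_inf' _ _ := Tensor.gc_mul.u_inf
  map_top' := Tensor.gc_mul.u_top
  map_sSup' s := by rw [h.mulRightAdjoint_sSup, sSup_image]

/-- The multiplication map, with `m^* = μ_*`. -/
def m (h : IsMultiplicativeQuantalFrame Q) : h.pairs ⟶ h.arrows :=
  @localeMap h.pairs h.arrows h.mHom

theorem lift_m_apply (h : IsMultiplicativeQuantalFrame Q) {X : Locale.{u}} (f g : X ⟶ h.arrows)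
    (w : f ≫ h.r = g ≫ h.d) (a : Q) :
    (inverseImage (h.isPullback.lift f g w ≫ h.m) : FrameHom Q X) a =
      ⨆ p ∈ {p : Q × Q | p.1 * p.2 ≤ a},
        inverseImage f (p.1 : Q) ⊓ inverseImage g (p.2 : Q) := by
  have hl : h.isPullback.lift f g w = h.pairMap f g w :=
    h.pairs_hom_ext ((h.isPullback.lift_fst f g w).trans (h.pairMap_fst f g w).symm)
      ((h.isPullback.lift_snd f g w).trans (h.pairMap_snd f g w).symm)
  rw [hl]
  rfl

theorem m_d (h : IsMultiplicativeQuantalFrame Q) : h.m ≫ h.d = h.π₁ ≫ h.d := by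
  refine localeMap_ext fun a => ?_
  obtain ⟨a, ha⟩ : Set.Iic (1 : Q) := a
  change Tensor.mulRightAdjoint (a * ⊤) = Tensor.tmul (a * ⊤) ⊤
  apply le_antisymm
  · rintro ⟨x, y⟩ hxy
    replace hxy : x * y ≤ a * ⊤ := hxy
    refine (Tensor.tmul (a * ⊤) ⊤).lower le_rfl
      ((h.le_mul y).trans (mul_le_mul'' le_rfl le_top)) ?_
    refine ((Tensor.tmul (a * ⊤) ⊤).balanced _ _ _ inf_le_right).1 ?_
    refine (Tensor.tmul (a * ⊤) ⊤).lower ?_ le_rfl (Tensor.mem_tmul _ _)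
    calc x * (y * ⊤ ⊓ 1) ≤ x * (y * star y) := mul_le_mul'' le_rfl (h.le_mul_star y)
      _ = (x * y) * star y := (mul_assoc _ _ _).symm
      _ ≤ (a * ⊤) * ⊤ := mul_le_mul'' hxy le_top
      _ = a * (⊤ * ⊤) := mul_assoc _ _ _
      _ ≤ a * ⊤ := mul_le_mul'' le_rfl le_top
  · refine Tensor.tmul_le.2 ?_
    change (a * ⊤) * ⊤ ≤ a * ⊤
    rw [mul_assoc]
    exact mul_le_mul'' le_rfl le_top

theorem m_r (h : IsMultiplicativeQuantalFrame Q) : h.m ≫ h.r = h.π₂ ≫ h.r := by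
  refine localeMap_ext fun a => ?_
  obtain ⟨a, ha⟩ : Set.Iic (1 : Q) := a
  change Tensor.mulRightAdjoint (star (a * ⊤)) = Tensor.tmul ⊤ (star (a * ⊤))
  rw [h.star_mul_top ha]
  apply le_antisymm
  · rintro ⟨x, y⟩ hxy
    replace hxy : x * y ≤ ⊤ * a := hxy
    have ht : star x * ⊤ ⊓ 1 ≤ 1 := inf_le_right
    have hx : x ≤ x * (star x * ⊤ ⊓ 1) := by
      have := star_mono (h.le_mul (star x))
      rwa [star_star, star_mul, star_star, h.star_eq ht] at this
    refine (Tensor.tmul ⊤ (⊤ * a)).lower (hx.trans (mul_le_mul'' le_top le_rfl)) le_rfl ?_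
    refine ((Tensor.tmul ⊤ (⊤ * a)).balanced _ _ _ ht).2 ?_
    refine (Tensor.tmul ⊤ (⊤ * a)).lower le_rfl ?_ (Tensor.mem_tmul _ _)
    calc (star x * ⊤ ⊓ 1) * y ≤ (star x * x) * y :=
          mul_le_mul'' (by simpa using h.le_mul_star (star x)) le_rfl
      _ = star x * (x * y) := mul_assoc _ _ _
      _ ≤ ⊤ * (⊤ * a) := mul_le_mul'' le_top hxy
      _ = (⊤ * ⊤) * a := (mul_assoc _ _ _).symm
      _ ≤ ⊤ * a := mul_le_mul'' le_top le_rfl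
  · refine Tensor.tmul_le.2 ?_
    change ⊤ * (⊤ * a) ≤ ⊤ * a
    rw [← mul_assoc]
    exact mul_le_mul'' le_top le_rfl

theorem u_d (h : IsMultiplicativeQuantalFrame Q) : h.u ≫ h.d = 𝟙 h.units := by
  refine localeMap_ext fun a => ?_
  obtain ⟨a, ha⟩ : Set.Iic (1 : Q) := a
  exact Subtype.ext (h.mul_top_inf_one ha)

theorem u_r (h : IsMultiplicativeQuantalFrame Q) : h.u ≫ h.r = 𝟙 h.units := by
  refine localeMap_ext fun a => ?_
  obtain ⟨a, ha⟩ : Set.Iic (1 : Q) := a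
  refine Subtype.ext ?_
  change star (a * ⊤) ⊓ 1 = a
  rw [h.star_mul_top ha, h.top_mul_inf ha, one_mul]

theorem unit_mul (h : IsMultiplicativeQuantalFrame Q)
    (w : (h.d ≫ h.u) ≫ h.r = 𝟙 h.arrows ≫ h.d) :
    h.isPullback.lift (h.d ≫ h.u) (𝟙 h.arrows) w ≫ h.m = 𝟙 h.arrows := by
  refine localeMap_ext fun a => ?_
  refine (h.lift_m_apply _ _ w a).trans ?_
  suffices key : ∀ a : Q, ⨆ p ∈ {p : Q × Q | p.1 * p.2 ≤ a}, (p.1 ⊓ 1) * ⊤ ⊓ p.2 = a from key a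
  intro a
  apply le_antisymm
  · refine iSup₂_le fun p hp => ?_
    rw [h.mul_top_inf inf_le_right]
    exact (mul_le_mul'' inf_le_left le_rfl).trans hp
  · refine le_iSup₂_of_le ((1 : Q), a) (one_mul a).le ?_
    rw [h.mul_top_inf inf_le_right, inf_idem]
    exact (one_mul a).ge

theorem mul_unit (h : IsMultiplicativeQuantalFrame Q)
    (w : 𝟙 h.arrows ≫ h.r = (h.r ≫ h.u) ≫ h.d) :
    h.isPullback.lift (𝟙 h.arrows) (h.r ≫ h.u) w ≫ h.m = 𝟙 h.arrows := by
  refine localeMap_ext fun a => ?_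
  refine (h.lift_m_apply _ _ w a).trans ?_
  suffices key : ∀ a : Q, ⨆ p ∈ {p : Q × Q | p.1 * p.2 ≤ a}, p.1 ⊓ star ((p.2 ⊓ 1) * ⊤) = a from key a
  intro a
  apply le_antisymm
  · refine iSup₂_le fun p hp => ?_
    rw [h.star_mul_top inf_le_right, inf_comm, h.top_mul_inf inf_le_right]
    exact (mul_le_mul'' le_rfl inf_le_left).trans hp
  · refine le_iSup₂_of_le (a, (1 : Q)) (mul_one a).le ?_
    rw [h.star_mul_top inf_le_right, inf_comm, h.top_mul_inf inf_le_right, inf_idem]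
    exact (mul_one a).ge

theorem assoc (h : IsMultiplicativeQuantalFrame Q) {X : Locale.{u}} (f g k : X ⟶ h.arrows)
    (hfg : f ≫ h.r = g ≫ h.d) (hgk : g ≫ h.r = k ≫ h.d)
    (w₁ : (h.isPullback.lift f g hfg ≫ h.m) ≫ h.r = k ≫ h.d)
    (w₂ : f ≫ h.r = (h.isPullback.lift g k hgk ≫ h.m) ≫ h.d) :
    h.isPullback.lift (h.isPullback.lift f g hfg ≫ h.m) k w₁ ≫ h.m =
      h.isPullback.lift f (h.isPullback.lift g k hgk ≫ h.m) w₂ ≫ h.m := by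
  refine localeMap_ext fun a => ?_
  refine (h.lift_m_apply _ _ w₁ a).trans (Eq.trans ?_ (h.lift_m_apply _ _ w₂ a).symm)
  apply le_antisymm
  · refine iSup₂_le fun p hp => ?_
    refine (inf_le_inf_right _ (h.lift_m_apply f g hfg p.1).le).trans ?_
    rw [iSup₂_inf_eq]
    refine iSup₂_le fun q hq => ?_
    refine le_iSup₂_of_le (q.1, q.2 * p.2) ?_ ?_
    · change q.1 * (q.2 * p.2) ≤ (a : Q)
      rw [← mul_assoc]
      exact (mul_le_mul'' hq le_rfl).trans hp
    · rw [inf_assoc]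
      refine inf_le_inf_left _ (le_trans ?_ (h.lift_m_apply g k hgk (q.2 * p.2)).ge)
      exact le_iSup₂_of_le (q.2, p.2) (le_refl (q.2 * p.2)) le_rfl
  · refine iSup₂_le fun p hp => ?_
    refine (inf_le_inf_left _ (h.lift_m_apply g k hgk p.2).le).trans ?_
    rw [inf_iSup₂_eq]
    refine iSup₂_le fun q hq => ?_
    refine le_iSup₂_of_le (p.1 * q.1, q.2) ?_ ?_
    · change (p.1 * q.1) * q.2 ≤ (a : Q)
      rw [mul_assoc]
      exact (mul_le_mul'' le_rfl hq).trans hp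
    · rw [← inf_assoc]
      refine inf_le_inf_right _ (le_trans ?_ (h.lift_m_apply f g hfg (p.1 * q.1)).ge)
      exact le_iSup₂_of_le (p.1, q.1) (le_refl (p.1 * q.1)) le_rfl

/-- The localic category associated to a multiplicative quantal frame. -/
def localicCategory (h : IsMultiplicativeQuantalFrame Q) : InternalCategory Locale.{u} where
  units := h.units
  arrows := h.arrows
  pairs := h.pairs
  d := h.d
  r := h.r
  u := h.u
  π₁ := h.π₁
  π₂ := h.π₂
  isPullback := h.isPullback
  m := h.m
  u_d := h.u_d
  u_r := h.u_r
  m_d := h.m_d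
  m_r := h.m_r
  unit_mul := h.unit_mul _
  mul_unit := h.mul_unit _
  assoc f g k hfg hgk := h.assoc f g k hfg hgk _ _

end IsMultiplicativeQuantalFrame

end Quantal

/-! Partial units play the role of local bisections, and the proof shows that covering by them is
the same as inverting arrows.

If they cover, `1 = ⋁ s`, every estimate can be made piecewise on partial units, where `s s* ≤ e`
and `s* s ≤ e` allow cancellation. This gives stability, multiplicativity of `μ_*`
(`isMultiplicativeQuantalFrame`), local injectivity of `d` (`d_isLocalHomeomorphism`) and the
groupoid laws for the involution. By the formula for `m^*`, the law `m ∘ ⟨id, i⟩ = u ∘ d` reads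
`⋁_{xy ≤ a} x ∧ y* = (a ∧ e)1`. Here `≤` holds in every stable quantal frame (`inf_star_le`); only
`≥` needs the cover.

Conversely, let `j` be any inversion. The inequality that always holds says that `id · i` lies below
`u ∘ d` in the pointwise order on inverse images. Left multiplication by `j` is monotone and turns
it into `i ≤ j`; since both maps are involutions, this forces `j = i` (`eq_i_of_isInversion`). The
law at `a = e` then writes `1` as a join of elements `z` with `z z* ≤ e`. Meeting this cover with
its image under the involution gives a cover by partial units (`sSup_partialUnits`). -/

namespace Quantal

/-! ### Inverses in internal categories -/

namespace InternalCategory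

variable {C : Type v} [Category.{w} C] (G : InternalCategory C)

/-- The product `m ∘ ⟨f, g⟩` of two composable generalized elements. -/
noncomputable def mul {X : C} (f g : X ⟶ G.arrows) (w : f ≫ G.r = g ≫ G.d) : X ⟶ G.arrows :=
  G.isPullback.lift f g w ≫ G.m

/-- Naturality in the stage of definition: it lets the laws of an internal groupoid be used on
arbitrary generalized elements, as in an ordinary group computation. -/
theorem comp_mul {X Y : C} (k : Y ⟶ X) (f g : X ⟶ G.arrows) (w : f ≫ G.r = g ≫ G.d) :
    k ≫ G.mul f g w = G.mul (k ≫ f) (k ≫ g) (by rw [Category.assoc, Category.assoc, w]) := by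
  rw [mul, mul, ← Category.assoc]
  congr 1
  apply G.isPullback.hom_ext <;> simp

theorem mul_congr {X : C} {f f' g g' : X ⟶ G.arrows} (hf : f = f') (hg : g = g')
    (w : f ≫ G.r = g ≫ G.d) : G.mul f g w = G.mul f' g' (by rw [← hf, ← hg, w]) := by
  subst hf hg
  rfl

theorem unit_mul' {X : C} (f e : X ⟶ G.arrows) (he : e = f ≫ G.d ≫ G.u)
    (w : e ≫ G.r = f ≫ G.d) : G.mul e f w = f :=
  (G.mul_congr he (Category.comp_id f).symm w).trans ((G.comp_mul f _ _ _).symm.trans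
    ((congrArg (f ≫ ·) G.unit_mul).trans (Category.comp_id f)))

theorem mul_unit' {X : C} (f e : X ⟶ G.arrows) (he : e = f ≫ G.r ≫ G.u)
    (w : f ≫ G.r = e ≫ G.d) : G.mul f e w = f :=
  (G.mul_congr (Category.comp_id f).symm he w).trans ((G.comp_mul f _ _ _).symm.trans
    ((congrArg (f ≫ ·) G.mul_unit).trans (Category.comp_id f)))

theorem mul_d {X : C} (f g : X ⟶ G.arrows) (w : f ≫ G.r = g ≫ G.d) :
    G.mul f g w ≫ G.d = f ≫ G.d := by
  rw [mul, Category.assoc, G.m_d, IsPullback.lift_fst_assoc]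

theorem mul_r {X : C} (f g : X ⟶ G.arrows) (w : f ≫ G.r = g ≫ G.d) :
    G.mul f g w ≫ G.r = g ≫ G.r := by
  rw [mul, Category.assoc, G.m_r, IsPullback.lift_snd_assoc]

theorem mul_assoc {X : C} (f g k : X ⟶ G.arrows) (hfg : f ≫ G.r = g ≫ G.d)
    (hgk : g ≫ G.r = k ≫ G.d) :
    G.mul (G.mul f g hfg) k (by rw [mul_r, hgk]) =
      G.mul f (G.mul g k hgk) (by rw [mul_d, hfg]) :=
  G.assoc f g k hfg hgk

variable {G}

/-- An inversion is an involution. -/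
theorem IsInversion.comp_self {j : G.arrows ⟶ G.arrows} (hj : G.IsInversion j) :
    j ≫ j = 𝟙 G.arrows := by
  have w₁ : (j ≫ j) ≫ G.r = j ≫ G.d := by rw [Category.assoc, hj.i_r]
  have w₂ : j ≫ G.r = 𝟙 _ ≫ G.d := by rw [Category.id_comp, hj.i_r]
  -- The classical computation `(x⁻¹)⁻¹ = (x⁻¹)⁻¹ (x⁻¹ x) = ((x⁻¹)⁻¹ x⁻¹) x = x`. This bracket is
  -- the law `x⁻¹ x = 1` with `x⁻¹` substituted for `x`.
  have e₁ : G.mul (j ≫ j) j w₁ = 𝟙 _ ≫ G.d ≫ G.u := by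
    refine (G.mul_congr rfl (Category.comp_id j).symm w₁).trans
      ((G.comp_mul j _ _ _).symm.trans ((congrArg (j ≫ ·) hj.inv_mul).trans ?_))
    simp only [← Category.assoc, hj.i_r, Category.id_comp]
  have e₂ : G.mul j (𝟙 _) w₂ = (j ≫ j) ≫ G.r ≫ G.u := by
    rw [Category.assoc, ← Category.assoc j G.r, hj.i_r, ← Category.assoc, hj.i_d]
    exact hj.inv_mul
  have h := G.mul_assoc (j ≫ j) j (𝟙 _) w₁ w₂
  rw [G.unit_mul' _ _ e₁, G.mul_unit' _ _ e₂] at h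
  exact h.symm

/-- Multiplying `m ∘ ⟨id, k⟩` on the left by an inversion gives `k`. -/
theorem IsInversion.mul_mul {j : G.arrows ⟶ G.arrows} (hj : G.IsInversion j)
    {k : G.arrows ⟶ G.arrows} (hk : 𝟙 G.arrows ≫ G.r = k ≫ G.d)
    (w : j ≫ G.r = G.mul (𝟙 G.arrows) k hk ≫ G.d) :
    G.mul j (G.mul (𝟙 G.arrows) k hk) w = k := by
  have w₁ : j ≫ G.r = 𝟙 _ ≫ G.d := by rw [Category.id_comp, hj.i_r]
  refine (G.mul_assoc j (𝟙 _) k w₁ hk).symm.trans (G.unit_mul' _ _ ?_ _)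
  rw [← Category.assoc, ← hk, Category.id_comp]
  exact hj.inv_mul

/-- Multiplying `u ∘ d` on the left by an inversion gives the inversion. -/
theorem IsInversion.mul_unit {j : G.arrows ⟶ G.arrows} (hj : G.IsInversion j)
    (w : j ≫ G.r = (G.d ≫ G.u) ≫ G.d) : G.mul j (G.d ≫ G.u) w = j :=
  G.mul_unit' _ _ (by rw [← Category.assoc, hj.i_r]) w

end InternalCategory

/-! ### Inverse quantal frames -/

section PartialUnits

variable {Q : Type u} [CompleteLattice Q] [Monoid Q] [IsQuantale Q] [StarMul Q]
  [IsInvolutiveQuantale Q]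

theorem partialUnits_of_le {a b : Q} (hab : a ≤ b) (hb : b ∈ partialUnits Q) :
    a ∈ partialUnits Q :=
  ⟨(mul_le_mul'' hab (star_mono hab)).trans hb.1, (mul_le_mul'' (star_mono hab) hab).trans hb.2⟩

/-! ### Openness of the domain map and local sections given by partial units. -/

namespace IsStableQuantalFrame

theorem le_mul_star_mul (h : IsStableQuantalFrame Q) (a : Q) : a ≤ a * star a * a :=
  (h.le_mul a).trans (mul_le_mul'' (h.le_mul_star a) le_rfl)

/-- The support of a stable quantal frame. -/
theorem exists_support (h : IsStableQuantalFrame Q) : ∃ ς : sSupHom Q Q, IsSupport Q ς :=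
  ⟨{ toFun := fun a => a * ⊤ ⊓ 1
     map_sSup' := fun s => by
      rw [sSup_mul_distrib, ← sSup_image, h.sSup_inf_eq', iSup_image, sSup_image] },
    { le_one := fun _ => inf_le_right
      le_mul_star := h.le_mul_star
      le_mul := h.le_mul }⟩

/-- The direct image is the support. Frobenius reciprocity holds because meeting with `b1`, for `b ≤
e`, is left multiplication by `b`, which passes through `- · 1` and through meets. -/
theorem d_isOpenLocaleMap (h : IsStableQuantalFrame Q) : IsOpenLocaleMap h.d := by
  let ς : Q → Set.Iic (1 : Q) := fun a => ⟨a * ⊤ ⊓ 1, inf_le_right⟩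
  refine ⟨ς, h.gc_support_dHom, ?_⟩
  intro a b
  obtain ⟨b, hb⟩ : Set.Iic (1 : Q) := b
  refine Subtype.ext ?_
  suffices key : ∀ a b : Q, b ≤ 1 → (a ⊓ b * ⊤) * ⊤ ⊓ 1 = (a * ⊤ ⊓ 1) ⊓ b from key a b hb
  clear hb b a
  intro a b hb
  rw [inf_comm a, h.mul_top_inf hb, mul_assoc, h.inf_mul_left hb, inf_comm _ b,
    h.inf_eq_mul hb inf_le_right]

/-- If the partial units cover, then the domain map is a local homeomorphism. -/
theorem d_isLocalHomeomorphism (h : IsStableQuantalFrame Q)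
    (hQ : sSup (partialUnits Q) = ⊤) : IsLocalHomeomorphism h.d := by
  let ς : Q → Set.Iic (1 : Q) := fun a => ⟨a * ⊤ ⊓ 1, inf_le_right⟩
  refine ⟨h.d_isOpenLocaleMap, partialUnits Q, hQ, ?_⟩
  -- An element `x` below a partial unit `a` is recovered from its support: `(ςx)1 ∧ a = (ςx)a`, and
  -- `(ςx)a ≤ x x* a ≤ x a* a ≤ x`.
  suffices key : ∀ a ∈ partialUnits Q, ∀ x ≤ a, (x * ⊤ ⊓ 1) * ⊤ ⊓ a = x from
    fun a ha x hx => ⟨ς x, key a ha x hx⟩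
  intro a ha x hx
  rw [h.mul_top_inf inf_le_right]
  apply le_antisymm
  · calc (x * ⊤ ⊓ 1) * a ≤ (x * star x) * a := mul_le_mul'' (h.le_mul_star x) le_rfl
      _ = x * (star x * a) := mul_assoc _ _ _
      _ ≤ x * (star a * a) := mul_le_mul'' le_rfl (mul_le_mul'' (star_mono hx) le_rfl)
      _ ≤ x * 1 := mul_le_mul'' le_rfl ha.2
      _ = x := mul_one x
  · exact (h.le_mul x).trans (mul_le_mul'' le_rfl hx)

/-- For `z = x ∧ y*` one has `z z* ≤ xy ≤ a`, so `ςz ≤ a ∧ e`, and `z ≤ (ςz)z`. This is the half of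
the inverse law `m ∘ ⟨id, i⟩ = u ∘ d` that needs no cover by partial units. -/
theorem inf_star_le (h : IsStableQuantalFrame Q) {a x y : Q} (hxy : x * y ≤ a) :
    x ⊓ star y ≤ (a ⊓ 1) * ⊤ := by
  refine (h.le_mul _).trans (mul_le_mul'' (le_inf ((h.le_mul_star _).trans ?_) inf_le_right)
    le_top)
  refine (mul_le_mul'' inf_le_left ?_).trans hxy
  exact star_le_iff.2 inf_le_right

end IsStableQuantalFrame

/-! ### Stability and multiplicativity from a cover by partial units. -/

namespace IsInverseQuantalFrame

/-- Any support satisfies `ςa ≤ a1 ∧ e`, which gives the second axiom. For the first, `a1 ∧ e` is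
the join of the elements `x = e ∧ as` with `s` a partial unit; since `x ≤ e`, the support yields `x
≤ xx*`, and `s s* ≤ e` removes `s` from `(as)(as)*`. -/
theorem isStableQuantalFrame (h : IsInverseQuantalFrame Q) : IsStableQuantalFrame Q where
  isQuantalFrame := h.isQuantalFrame
  le_mul_star a := by
    obtain ⟨ς, hς⟩ := h.exists_support
    rw [← h.sSup_partialUnits, mul_sSup_distrib, ← sSup_image, inf_comm, h.isQuantalFrame,
      iSup_image]
    refine iSup₂_le fun s hs => ?_
    have hx : 1 ⊓ a * s ≤ 1 := inf_le_left
    calc 1 ⊓ a * s ≤ ς (1 ⊓ a * s) * (1 ⊓ a * s) := hς.le_mul _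
      _ ≤ ς (1 ⊓ a * s) * 1 := mul_le_mul'' le_rfl hx
      _ = ς (1 ⊓ a * s) := mul_one _
      _ ≤ (1 ⊓ a * s) * star (1 ⊓ a * s) := hς.le_mul_star _
      _ ≤ (a * s) * star (a * s) := mul_le_mul'' inf_le_right (star_mono inf_le_right)
      _ = a * (s * star s) * star a := by simp only [star_mul, mul_assoc]
      _ ≤ a * 1 * star a := mul_le_mul'' (mul_le_mul'' le_rfl hs.1) le_rfl
      _ = a * star a := by rw [mul_one]
  le_mul a := by
    obtain ⟨ς, hς⟩ := h.exists_support
    exact (hς.le_mul a).trans (mul_le_mul'' (le_inf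
      ((hς.le_mul_star a).trans (mul_le_mul'' le_rfl le_top)) (hς.le_one a)) le_rfl)

/-- A pair `(x, y)` with `xy ≤ ⋁S` is cut into pairs `(t, y)` with `t` a partial unit. Moving `t*t ≤
e` across the tensor replaces `y` by `t*ty ≤ ⋁ t*a` over `a ∈ S`, and each `(t, t*a)` lies in
`μ_*(a)` because `tt* ≤ e`. -/
theorem isMultiplicativeQuantalFrame (h : IsInverseQuantalFrame Q) :
    IsMultiplicativeQuantalFrame Q where
  toIsStableQuantalFrame := h.isStableQuantalFrame
  mulRightAdjoint_sSup S := by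
    have hs := h.isStableQuantalFrame
    apply le_antisymm
    · rintro ⟨x, y⟩ hxy
      replace hxy : x * y ≤ sSup S := hxy
      have hx : x = sSup ((x ⊓ ·) '' partialUnits Q) := by
        rw [sSup_image, ← h.isQuantalFrame, h.sSup_partialUnits, inf_top_eq]
      rw [hx]
      refine Tensor.sSup_left _ _ _ ?_
      rintro _ ⟨s, hs', rfl⟩
      have ht : x ⊓ s ∈ partialUnits Q := partialUnits_of_le inf_le_right hs'
      have hty : (x ⊓ s) * y ≤ sSup S := (mul_le_mul'' inf_le_left le_rfl).trans hxy
      change (x ⊓ s, y) ∈ _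
      generalize x ⊓ s = t at ht hty ⊢
      have hle : t ≤ t * (star t * t) := by simpa [mul_assoc] using hs.le_mul_star_mul t
      -- Since `t ≤ t(t*t)`, it suffices to treat the pair `(t(t*t), y)`, to which balancedness over
      -- `t*t ≤ e` applies.
      refine Tensor.lower _ hle le_rfl ?_
      refine (Tensor.balanced _ _ _ _ ht.2).2 ?_
      refine Tensor.lower _ le_rfl (b := sSup ((star t * ·) '' S)) ?_ ?_
      · rw [mul_assoc, sSup_image, ← mul_sSup_distrib]
        exact mul_le_mul'' le_rfl hty
      · refine Tensor.sSup_right _ _ _ ?_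
        rintro _ ⟨a, ha, rfl⟩
        refine (le_iSup₂_of_le a ha le_rfl : Tensor.mulRightAdjoint a ≤
          ⨆ a ∈ S, Tensor.mulRightAdjoint a) (Tensor.mem_mulRightAdjoint.2 ?_)
        rw [← mul_assoc]
        simpa using mul_le_mul'' ht.1 (le_refl a)
    · exact iSup₂_le fun a ha => Tensor.gc_mul.monotone_u (le_sSup ha)

end IsInverseQuantalFrame

end PartialUnits

/-! ### The involution as the only possible inversion. -/

namespace IsMultiplicativeQuantalFrame

variable {Q : Type u} [CompleteLattice Q] [Monoid Q] [IsQuantale Q] [StarMul Q]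
  [IsInvolutiveQuantale Q]

theorem i_comp_i (h : IsMultiplicativeQuantalFrame Q) : h.i ≫ h.i = 𝟙 h.arrows :=
  localeMap_ext fun a => star_star (R := Q) a

theorem i_comp_r (h : IsMultiplicativeQuantalFrame Q) : h.i ≫ h.r = h.d := by
  change h.i ≫ h.i ≫ h.d = h.d
  rw [← Category.assoc, h.i_comp_i, Category.id_comp]

/-- The pointwise form of the law `m ∘ ⟨id, i⟩ = u ∘ d`. -/
theorem iSup_inf_star (h : IsMultiplicativeQuantalFrame Q) (hQ : sSup (partialUnits Q) = ⊤)
    (a : Q) : ⨆ p ∈ {p : Q × Q | p.1 * p.2 ≤ a}, p.1 ⊓ star p.2 = (a ⊓ 1) * ⊤ := by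
  apply le_antisymm
  · exact iSup₂_le fun p hp => h.inf_star_le hp
  · rw [← hQ, mul_sSup_distrib]
    refine iSup₂_le fun s hs => ?_
    -- A pair `(x, x*)` contributes `x ∧ x** = x` to the join, and `x = (a ∧ e)s` satisfies `xx* ≤
    -- a`.
    refine le_iSup₂_of_le ((a ⊓ 1) * s, star ((a ⊓ 1) * s)) ?_ (by simp)
    calc (a ⊓ 1) * s * star ((a ⊓ 1) * s) = (a ⊓ 1) * (s * star s) * star (a ⊓ 1) := by
          simp only [star_mul, mul_assoc]
      _ ≤ a * 1 * 1 := mul_le_mul'' (mul_le_mul'' inf_le_left hs.1)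
          (IsStableQuantalFrame.star_le_one inf_le_right)
      _ = a := by simp

/-- The pointwise form of the law `m ∘ ⟨i, id⟩ = u ∘ r`. -/
theorem iSup_star_inf (h : IsMultiplicativeQuantalFrame Q) (hQ : sSup (partialUnits Q) = ⊤)
    (a : Q) :
    ⨆ p ∈ {p : Q × Q | p.1 * p.2 ≤ a}, star p.1 ⊓ p.2 = star ((a ⊓ 1) * ⊤) := by
  apply le_antisymm
  · refine iSup₂_le fun p hp => ?_
    -- The involution carries this bound to the one for the other inverse law; `a*` may be replaced
    -- by `a` because the involution fixes elements below `e`.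
    have := star_mono (h.inf_star_le (a := star a) (x := star p.2) (y := star p.1)
      (by rw [← star_mul]; exact star_mono hp))
    have h₁ : star a ⊓ 1 = a ⊓ 1 := by
      rw [← h.star_eq (inf_le_right : a ⊓ 1 ≤ 1), star_inf', star_one]
    rw [star_star, star_inf', star_star, h₁, inf_comm] at this
    exact this
  · rw [h.star_mul_top inf_le_right, ← hQ, sSup_mul_distrib]
    refine iSup₂_le fun s hs => ?_
    refine le_iSup₂_of_le (star (s * (a ⊓ 1)), s * (a ⊓ 1)) ?_ (by simp)
    calc star (s * (a ⊓ 1)) * (s * (a ⊓ 1)) = star (a ⊓ 1) * (star s * s) * (a ⊓ 1) := by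
          simp only [star_mul, mul_assoc]
      _ ≤ 1 * 1 * a := mul_le_mul'' (mul_le_mul''
          (IsStableQuantalFrame.star_le_one inf_le_right) hs.2) inf_le_left
      _ = a := by simp

theorem isInversion_i (h : IsMultiplicativeQuantalFrame Q) (hQ : sSup (partialUnits Q) = ⊤) :
    h.localicCategory.IsInversion h.i where
  i_d := rfl
  i_r := h.i_comp_r
  mul_inv := localeMap_ext fun a =>
    (h.lift_m_apply (𝟙 h.arrows) h.i _ a).trans (h.iSup_inf_star hQ a)
  inv_mul := localeMap_ext fun a =>
    (h.lift_m_apply h.i (𝟙 h.arrows) _ a).trans (h.iSup_star_inf hQ a)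

/-- Multiplication on the left is monotone for the specialization order on locale maps. -/
theorem mul_le_mul_left (h : IsMultiplicativeQuantalFrame Q) {X : Locale.{u}}
    {f g g' : X ⟶ h.arrows} (w : f ≫ h.r = g ≫ h.d) (w' : f ≫ h.r = g' ≫ h.d)
    (hg : ∀ a : Q, (inverseImage g : FrameHom Q X) a ≤ (inverseImage g' : FrameHom Q X) a)
    (a : Q) :
    (inverseImage (h.localicCategory.mul f g w) : FrameHom Q X) a ≤
      (inverseImage (h.localicCategory.mul f g' w') : FrameHom Q X) a := by
  refine (h.lift_m_apply f g w a).le.trans (le_trans ?_ (h.lift_m_apply f g' w' a).ge)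
  exact iSup₂_mono fun p _ => inf_le_inf_left _ (hg p.2)

/-- The involution lies below every inversion. -/
theorem star_le_of_isInversion (h : IsMultiplicativeQuantalFrame Q) {j : h.arrows ⟶ h.arrows}
    (hj : h.localicCategory.IsInversion j) (a : Q) :
    star a ≤ (inverseImage j : FrameHom Q h.arrows) a := by
  have w₂ : 𝟙 h.arrows ≫ h.r = h.i ≫ h.d := Category.id_comp _
  have w₁ : j ≫ h.r = h.localicCategory.mul (𝟙 h.arrows) h.i w₂ ≫ h.d :=
    hj.i_r.trans ((h.localicCategory.mul_d (𝟙 h.arrows) h.i w₂).trans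
      (Category.id_comp h.d)).symm
  have w₃ : j ≫ h.r = (h.d ≫ h.u) ≫ h.d :=
    hj.i_r.trans (by rw [Category.assoc, h.u_d]; exact (Category.comp_id h.d).symm)
  -- The inequality `id · i ≤ u ∘ d` multiplied on the left by `j`: the two sides become `i` and
  -- `j`.
  have hle := h.mul_le_mul_left w₁ w₃ (fun a =>
    (h.lift_m_apply (𝟙 h.arrows) h.i w₂ a).le.trans (iSup₂_le fun p hp => h.inf_star_le hp)) a
  have e₁ := congrArg (fun k : h.arrows ⟶ h.arrows => (inverseImage k : FrameHom Q h.arrows) a)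
    (hj.mul_mul w₂ w₁)
  have e₂ := congrArg (fun k : h.arrows ⟶ h.arrows => (inverseImage k : FrameHom Q h.arrows) a)
    (hj.mul_unit w₃)
  exact e₁.ge.trans (hle.trans e₂.le)

/-- The only possible inversion is the involution. -/
theorem eq_i_of_isInversion (h : IsMultiplicativeQuantalFrame Q) {j : h.arrows ⟶ h.arrows}
    (hj : h.localicCategory.IsInversion j) : j = h.i := by
  let J : FrameHom Q Q := @inverseImage h.arrows h.arrows j
  have hle : ∀ a : Q, star a ≤ J a := h.star_le_of_isInversion hj
  have hJJ : ∀ a : Q, J (J a) = a := fun a =>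
    congrArg (fun k : h.arrows ⟶ h.arrows => (inverseImage k : FrameHom Q h.arrows) a)
      hj.comp_self
  refine localeMap_ext fun a => ?_
  suffices key : ∀ a : Q, J a = star a from key a
  refine fun a => le_antisymm ?_ (hle a)
  -- Applying `J` to `a ≤ J(a*)` and using `J ∘ J = id` gives the reverse inequality `J a ≤ a*`.
  have h₁ := OrderHomClass.mono J (hle (star a))
  rw [hJJ, star_star] at h₁
  exact h₁

theorem isInversion_i_of_isGroupoid (h : IsMultiplicativeQuantalFrame Q)
    (hG : h.localicCategory.IsGroupoid) : h.localicCategory.IsInversion h.i := by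
  obtain ⟨j, hj⟩ := hG
  have := h.eq_i_of_isInversion hj
  rwa [this] at hj

/-- At `a = e` the inverse law says that the elements `z = x ∧ y*` with `xy ≤ e` cover. They are
only one-sided, `zz* ≤ e`; their images `z*` also cover and satisfy the other inequality, so the
meets `z ∧ w*` of the two families are partial units, and they cover by distributivity. -/
theorem sSup_partialUnits (h : IsMultiplicativeQuantalFrame Q)
    (hi : h.localicCategory.IsInversion h.i) : sSup (partialUnits Q) = ⊤ := by
  let := h.frame
  have e : ⨆ p ∈ {p : Q × Q | p.1 * p.2 ≤ 1}, p.1 ⊓ star p.2 = ((1 : Q) ⊓ 1) * ⊤ :=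
    (h.lift_m_apply (𝟙 h.arrows) h.i _ (1 : Q)).symm.trans
      (congrArg (fun k : h.arrows ⟶ h.arrows => (inverseImage k : FrameHom Q h.arrows) (1 : Q))
        hi.mul_inv)
  rw [inf_idem, one_mul] at e
  have hcov : (⊤ : Q) ≤ ⨆ p ∈ {p : Q × Q | p.1 * p.2 ≤ 1}, star (p.1 ⊓ star p.2) := by
    rw [← star_top', ← e, ← sSup_image, IsInvolutiveQuantale.star_sSup, iSup_image]
  have hmul : ∀ {x y : Q}, x * y ≤ 1 → (x ⊓ star y) * star (x ⊓ star y) ≤ 1 := fun hxy =>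
    (mul_le_mul'' inf_le_left (star_le_iff.2 inf_le_right)).trans hxy
  rw [← top_le_iff]
  calc (⊤ : Q) ≤ (⨆ p ∈ {p : Q × Q | p.1 * p.2 ≤ 1}, p.1 ⊓ star p.2) ⊓
        ⨆ p ∈ {p : Q × Q | p.1 * p.2 ≤ 1}, star (p.1 ⊓ star p.2) := le_inf e.ge hcov
    _ ≤ sSup (partialUnits Q) := by
      rw [iSup₂_inf_eq]
      refine iSup₂_le fun p hp => ?_
      rw [inf_iSup₂_eq]
      refine iSup₂_le fun q hq => le_sSup ⟨?_, ?_⟩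
      · exact (mul_le_mul'' inf_le_left (star_mono inf_le_left)).trans (hmul hp)
      · refine (mul_le_mul'' (star_mono inf_le_right) inf_le_right).trans ?_
        rw [star_star]
        exact hmul hq

end IsMultiplicativeQuantalFrame

end Quantal

theorem mainTheorem1 (Q : Type u) [CompleteLattice Q] [Monoid Q] [IsQuantale Q] [StarMul Q]
    [Quantal.IsInvolutiveQuantale Q] :
    List.TFAE
      [Quantal.IsInverseQuantalFrame Q,
       ∃ h : Quantal.IsMultiplicativeQuantalFrame Q, h.localicCategory.IsGroupoid,
       ∃ h : Quantal.IsMultiplicativeQuantalFrame Q,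
         Quantal.IsEtaleGroupoid h.localicCategory] ∧
    ∀ h : Quantal.IsMultiplicativeQuantalFrame Q, h.localicCategory.IsGroupoid →
      h.localicCategory.IsInversion h.i := by
  refine ⟨?_, fun h hG => h.isInversion_i_of_isGroupoid hG⟩
  tfae_have 1 → 3 := fun h =>
    ⟨h.isMultiplicativeQuantalFrame,
      ⟨_, h.isMultiplicativeQuantalFrame.isInversion_i h.sSup_partialUnits⟩,
      h.isStableQuantalFrame.d_isLocalHomeomorphism h.sSup_partialUnits⟩
  tfae_have 3 → 2 := fun ⟨h, hG⟩ => ⟨h, hG.1⟩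
  -- No étaleness is assumed here: the mere existence of an inversion produces the cover by partial
  -- units.
  tfae_have 2 → 1 := fun ⟨h, hG⟩ =>
    ⟨h.isQuantalFrame, h.exists_support, h.sSup_partialUnits (h.isInversion_i_of_isGroupoid hG)⟩
  tfae_finish
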